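/- **Theorem (The Faraday tensor).** Let $(M,g)$ be a smooth four-dimensional Lorentzian manifold of signature $(-,+,+,+)$ with Levi-Civita connection $\nabla$. Suppose it is static: there is a smooth vector field $u$ with $u^ku_k=-1$ and $\nabla_j u_k=-u_j\dot u_k$, where $\dot u_k=u^j\nabla_j u_k$, such that $\nabla_j\dot u_k=\nabla_k\dot u_j$ and $\eta:=\dot u^k\dot u_k>0$ everywhere. (A dot denotes the action of $u^k\nabla_k$.) At each point let $y,z$ be orthonormal space-like vectors orthogonal to $u$ and $\dot u$, chosen so that the tensor field $y_jz_k-y_kz_j$ is smooth. Let $\mathbb E,\mathbb B$ be smooth scalar fields with $\dot{\mathbb E}=u^k\nabla_k\mathbb E=0$ and $\dot{\mathbb B}=u^k\nabla_k\mathbb B=0$, and put $$F_{jk}=\frac{\mathbb E}{\sqrt\eta}\,(u_j\dot u_k-\dot u_ju_k)+\mathbb B\,(y_jz_k-y_kz_j).$$ Then $F$ is a Faraday tensor, i.e. $\nabla_jF_{kl}+\nabla_kF_{lj}+\nabla_lF_{jk}=0$ on $M$, if and only if both of the following hold on $M$: 1. there is a scalar function $\varkappa$ with $\nabla_k\dfrac{\mathbb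 E}{\sqrt\eta}=\varkappa\,\dot u_k$; 2. $\dot u^k\nabla_k\mathbb B=\mathbb B\left[\eta-\nabla^k\dot u_k+\dfrac{\dot u^k\nabla_k\eta}{2\eta}\right]$. Moreover, any $\varkappa$ as in (1) is smooth and satisfies $\dot\varkappa=u^k\nabla_k\varkappa=0$. -/

import Mathlib

open Bundle Manifold VectorField
open scoped ContDiff Topology

noncomputable section

namespace StaticFaraday

/-- The covariant 2-tensor field `T` is smooth, as a section of the bundle of bilinear forms. -/
def TensorSmooth {M : Type*} [TopologicalSpace M] [ChartedSpace (EuclideanSpace ℝ (Fin 4)) M]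
    [IsManifold (𝓡 4) ∞ M]
    (T : ∀ x : M, TangentSpace (𝓡 4) x →L[ℝ] TangentSpace (𝓡 4) x →L[ℝ] ℝ) : Prop :=
  ContMDiff (𝓡 4)
    ((𝓡 4).prod 𝓘(ℝ, EuclideanSpace ℝ (Fin 4) →L[ℝ] EuclideanSpace ℝ (Fin 4) →L[ℝ] ℝ)) ∞
    (fun x : M ↦ TotalSpace.mk'
      (EuclideanSpace ℝ (Fin 4) →L[ℝ] EuclideanSpace ℝ (Fin 4) →L[ℝ] ℝ)
      (E := fun x : M ↦ TangentSpace (𝓡 4) x →L[ℝ] TangentSpace (𝓡 4) x →L[ℝ] ℝ) x (T x))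

/-- Smooth Lorentzian metrics of signature `(-,+,+,+)` on a smooth 4-manifold `M`. -/
structure LorentzMetric (M : Type*) [TopologicalSpace M]
    [ChartedSpace (EuclideanSpace ℝ (Fin 4)) M] [IsManifold (𝓡 4) ∞ M] where
  /-- The scalar product `g x v w` on the tangent space at `x`. -/
  val : ∀ x : M, TangentSpace (𝓡 4) x →L[ℝ] TangentSpace (𝓡 4) x →L[ℝ] ℝ
  symm : ∀ (x : M) (v w : TangentSpace (𝓡 4) x), val x v w = val x w v
  signature : ∀ x : M, ∃ b : Module.Basis (Fin 4) ℝ (TangentSpace (𝓡 4) x),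
    ∀ i j, val x (b i) (b j) = if i = j then (if i = 0 then -1 else 1) else 0
  smooth : TensorSmooth val

variable {M : Type*} [TopologicalSpace M] [ChartedSpace (EuclideanSpace ℝ (Fin 4)) M]
  [IsManifold (𝓡 4) ∞ M]

/-- Vector fields on `M`, without any regularity. -/
abbrev VField (M : Type*) [TopologicalSpace M] [ChartedSpace (EuclideanSpace ℝ (Fin 4)) M] :=
  ∀ x : M, TangentSpace (𝓡 4) x

/-- The vector field `X` is differentiable at `x`. -/
abbrev VDiffAt (X : VField M) (x : M) : Prop :=
  MDifferentiableAt (𝓡 4) ((𝓡 4).prod 𝓘(ℝ, EuclideanSpace ℝ (Fin 4)))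
    (fun p ↦ TotalSpace.mk' (EuclideanSpace ℝ (Fin 4)) p (X p)) x

/-- The vector field `X` is smooth on `M`. -/
abbrev VSmooth (X : VField M) : Prop :=
  ContMDiff (𝓡 4) ((𝓡 4).prod 𝓘(ℝ, EuclideanSpace ℝ (Fin 4))) ∞
    (fun p ↦ TotalSpace.mk' (EuclideanSpace ℝ (Fin 4)) p (X p))

namespace LorentzMetric

variable (g : LorentzMetric M) {X X' Y Y' Z Z' : VField M} {f : M → ℝ} {x : M}

theorem mdiffAt (hX : VDiffAt X x) (hY : VDiffAt Y x) :
    MDifferentiableAt (𝓡 4) 𝓘(ℝ) (fun p ↦ g.val p (X p) (Y p)) x := by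
  have h1 := (ContMDiff.contMDiffAt (x := x) g.smooth).mdifferentiableAt (by simp)
  have h2 := MDifferentiableAt.clm_bundle_apply₂ (b := fun p : M ↦ p)
    (E₃ := Bundle.Trivial M ℝ) (F₃ := ℝ) h1 hX hY
  rw [mdifferentiableAt_section] at h2
  exact h2

theorem nondegenerate {v : TangentSpace (𝓡 4) x} (h : ∀ w, g.val x v w = 0) : v = 0 := by
  obtain ⟨b, hb⟩ := g.signature x
  rw [← b.sum_repr v]
  refine Finset.sum_eq_zero fun i _ ↦ ?_
  have h1 := h (b i)
  rw [← b.sum_repr v] at h1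
  simp only [map_sum, map_smul, sum_apply, smul_apply, hb] at h1
  simp at h1
  split_ifs at h1 <;> simp_all

/-- The right-hand side of the Koszul formula for `2 g(∇_X Y, Z)` at `x`. -/
def koszul (Y X Z : VField M) (x : M) : ℝ :=
  mvfderiv (𝓡 4) (fun p ↦ g.val p (Y p) (Z p)) x (X x)
    + mvfderiv (𝓡 4) (fun p ↦ g.val p (X p) (Z p)) x (Y x)
    - mvfderiv (𝓡 4) (fun p ↦ g.val p (X p) (Y p)) x (Z x)
    + g.val x (mlieBracket (𝓡 4) X Y x) (Z x)
    - g.val x (mlieBracket (𝓡 4) X Z x) (Y x)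
    - g.val x (mlieBracket (𝓡 4) Y Z x) (X x)

theorem mvfderiv_smul_left (hX : VDiffAt X x) (hY : VDiffAt Y x)
    (hf : MDifferentiableAt (𝓡 4) 𝓘(ℝ) f x) :
    mvfderiv (𝓡 4) (fun p ↦ g.val p ((f • X) p) (Y p)) x
      = f x • mvfderiv (𝓡 4) (fun p ↦ g.val p (X p) (Y p)) x
        + g.val x (X x) (Y x) • mvfderiv (𝓡 4) f x := by
  rw [← mvfderiv_mul hf (g.mdiffAt hX hY)]
  congr 1; ext p; simp

theorem mvfderiv_smul_right (hX : VDiffAt X x) (hY : VDiffAt Y x)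
    (hf : MDifferentiableAt (𝓡 4) 𝓘(ℝ) f x) :
    mvfderiv (𝓡 4) (fun p ↦ g.val p (X p) ((f • Y) p)) x
      = f x • mvfderiv (𝓡 4) (fun p ↦ g.val p (X p) (Y p)) x
        + g.val x (X x) (Y x) • mvfderiv (𝓡 4) f x := by
  rw [← mvfderiv_mul hf (g.mdiffAt hX hY)]
  congr 1; ext p; simp

theorem mvfderiv_add_left (hX : VDiffAt X x) (hX' : VDiffAt X' x) (hY : VDiffAt Y x) :
    mvfderiv (𝓡 4) (fun p ↦ g.val p ((X + X') p) (Y p)) x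
      = mvfderiv (𝓡 4) (fun p ↦ g.val p (X p) (Y p)) x
        + mvfderiv (𝓡 4) (fun p ↦ g.val p (X' p) (Y p)) x := by
  rw [← mvfderiv_add (g.mdiffAt hX hY) (g.mdiffAt hX' hY)]
  congr 1; ext p; simp

theorem mvfderiv_add_right (hX : VDiffAt X x) (hY : VDiffAt Y x) (hY' : VDiffAt Y' x) :
    mvfderiv (𝓡 4) (fun p ↦ g.val p (X p) ((Y + Y') p)) x
      = mvfderiv (𝓡 4) (fun p ↦ g.val p (X p) (Y p)) x
        + mvfderiv (𝓡 4) (fun p ↦ g.val p (X p) (Y' p)) x := by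
  rw [← mvfderiv_add (g.mdiffAt hX hY) (g.mdiffAt hX hY')]
  congr 1; ext p; simp

theorem koszul_tensorial_left (hY : VDiffAt Y x) (hZ : VDiffAt Z x) :
    TensorialAt (𝓡 4) (EuclideanSpace ℝ (Fin 4)) (fun X ↦ g.koszul Y X Z x) x where
  smul {f X} hf hX := by
    simp only [koszul, g.mvfderiv_smul_left hX hZ hf, g.mvfderiv_smul_left hX hY hf,
      mlieBracket_smul_left hf hX]
    simp
    ring
  add {X X'} hX hX' := by
    simp only [koszul, g.mvfderiv_add_left hX hX' hZ, g.mvfderiv_add_left hX hX' hY,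
      mlieBracket_add_left hX hX']
    simp
    ring

theorem koszul_tensorial_right (hY : VDiffAt Y x) (hX : VDiffAt X x) :
    TensorialAt (𝓡 4) (EuclideanSpace ℝ (Fin 4)) (fun Z ↦ g.koszul Y X Z x) x where
  smul {f Z} hf hZ := by
    simp only [koszul, g.mvfderiv_smul_right hX hZ hf, g.mvfderiv_smul_right hY hZ hf,
      mlieBracket_smul_right hf hZ]
    simp
    rw [g.symm x (Z x) (X x), g.symm x (Z x) (Y x)]
    ring
  add {Z Z'} hZ hZ' := by
    simp only [koszul, g.mvfderiv_add_right hX hZ hZ', g.mvfderiv_add_right hY hZ hZ',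
      mlieBracket_add_right hZ hZ']
    simp
    ring

theorem koszul_add (hY : VDiffAt Y x) (hY' : VDiffAt Y' x) (hX : VDiffAt X x)
    (hZ : VDiffAt Z x) : g.koszul (Y + Y') X Z x = g.koszul Y X Z x + g.koszul Y' X Z x := by
  simp only [koszul, g.mvfderiv_add_left hY hY' hZ, g.mvfderiv_add_right hX hY hY',
    mlieBracket_add_right hY hY', mlieBracket_add_left hY hY']
  simp
  ring

theorem koszul_smul (hf : MDifferentiableAt (𝓡 4) 𝓘(ℝ) f x) (hY : VDiffAt Y x)
    (hX : VDiffAt X x) (hZ : VDiffAt Z x) :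
    g.koszul (f • Y) X Z x
      = f x * g.koszul Y X Z x + 2 * (mvfderiv (𝓡 4) f x (X x) * g.val x (Y x) (Z x)) := by
  simp only [koszul, g.mvfderiv_smul_left hY hZ hf, g.mvfderiv_smul_right hX hY hf,
    mlieBracket_smul_right hf hY, mlieBracket_smul_left hf hY]
  simp
  rw [g.symm x (Y x) (X x)]
  ring

instance instFiniteDimensionalTangent (x : M) : FiniteDimensional ℝ (TangentSpace (𝓡 4) x) :=
  inferInstanceAs (FiniteDimensional ℝ (EuclideanSpace ℝ (Fin 4)))

instance instT2SpaceTangent (x : M) : T2Space (TangentSpace (𝓡 4) x) :=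
  inferInstanceAs (T2Space (EuclideanSpace ℝ (Fin 4)))

/-- Lowering an index, `v ↦ g(v, ·)`, as an isomorphism from tangent vectors to covectors. -/
def flat (x : M) :
    TangentSpace (𝓡 4) x ≃ₗ[ℝ] (TangentSpace (𝓡 4) x →ₗ[ℝ] ℝ) :=
  LinearEquiv.ofInjectiveOfFinrankEq
    (LinearMap.toContinuousLinearMap.symm.toLinearMap ∘ₗ (g.val x).toLinearMap)
    ((injective_iff_map_eq_zero _).2 fun v hv ↦ g.nondegenerate fun w ↦ by
      simpa using congr($hv w))
    (Subspace.dual_finrank_eq (K := ℝ) (V := TangentSpace (𝓡 4) x)).symm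

theorem flat_apply (v w : TangentSpace (𝓡 4) x) : g.flat x v w = g.val x v w := rfl

/-- The vector obtained from a covector by raising the index. -/
def sharp (x : M) : (TangentSpace (𝓡 4) x →L[ℝ] ℝ) →ₗ[ℝ] TangentSpace (𝓡 4) x :=
  (g.flat x).symm.toLinearMap ∘ₗ LinearMap.toContinuousLinearMap.symm.toLinearMap

theorem val_sharp (α : TangentSpace (𝓡 4) x →L[ℝ] ℝ) (w : TangentSpace (𝓡 4) x) :
    g.val x (g.sharp x α) w = α w := by
  rw [← flat_apply]
  simp [sharp]

theorem ext_val {v v' : TangentSpace (𝓡 4) x} (h : ∀ w, g.val x v w = g.val x v' w) : v = v' :=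
  sub_eq_zero.1 (g.nondegenerate fun w ↦ by simp [h])

open Classical in
/-- The covariant derivative `v ↦ ∇_v Y` at `x`, determined by the Koszul formula
(with the value `0` where `Y` is not differentiable). -/
def covAux (Y : VField M) (x : M) : TangentSpace (𝓡 4) x →L[ℝ] TangentSpace (𝓡 4) x :=
  if hY : VDiffAt Y x then
    LinearMap.toContinuousLinearMap (g.sharp x ∘ₗ (((1 / 2 : ℝ) •
      TensorialAt.mkHom₂ (I := 𝓡 4) (F := EuclideanSpace ℝ (Fin 4))
        (F' := EuclideanSpace ℝ (Fin 4)) (fun X Z ↦ g.koszul Y X Z x) x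
        (fun _ hZ ↦ g.koszul_tensorial_left hY hZ)
        (fun _ hX ↦ g.koszul_tensorial_right hY hX)).toLinearMap))
  else 0

theorem koszul_formula (hY : VDiffAt Y x) (hX : VDiffAt X x) (hZ : VDiffAt Z x) :
    g.val x (g.covAux Y x (X x)) (Z x) = 1 / 2 * g.koszul Y X Z x := by
  rw [covAux, dif_pos hY]
  have := TensorialAt.mkHom₂_apply (I := 𝓡 4) (F := EuclideanSpace ℝ (Fin 4))
        (F' := EuclideanSpace ℝ (Fin 4)) (Φ := fun X Z ↦ g.koszul Y X Z x) (x := x)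
        (fun _ hZ ↦ g.koszul_tensorial_left hY hZ)
        (fun _ hX ↦ g.koszul_tensorial_right hY hX) hX hZ
  rw [← this, LinearMap.coe_toContinuousLinearMap', LinearMap.comp_apply, val_sharp]
  simp

theorem vdiffAt_extend (v : TangentSpace (𝓡 4) x) :
    VDiffAt (FiberBundle.extend (EuclideanSpace ℝ (Fin 4)) v) x :=
  FiberBundle.mdifferentiableAt_extend ..

/-- The Levi-Civita connection of `g`. The argument order is `g.leviCivita Y x v`, for `∇_v Y` at
the point `x`. -/
def leviCivita :
    CovariantDerivative (𝓡 4) (EuclideanSpace ℝ (Fin 4)) (TangentSpace (𝓡 4) : M → Type _) where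
  toFun := g.covAux
  isCovariantDerivativeOnUniv :=
    { add := by
        intro Y Y' x hY hY' _
        ext1 v
        refine g.ext_val fun w ↦ ?_
        have hv := vdiffAt_extend v
        have hw := vdiffAt_extend w
        have h1 := g.koszul_formula (mdifferentiableAt_add_section hY hY') hv hw
        have h2 := g.koszul_formula hY hv hw
        have h3 := g.koszul_formula hY' hv hw
        rw [g.koszul_add hY hY' hv hw] at h1
        simp only [FiberBundle.extend_apply_self] at h1 h2 h3
        simp only [add_apply, map_add]
        linarith
      leibniz := by
        intro Y f x hY hf _
        ext1 v
        refine g.ext_val fun w ↦ ?_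
        have hv := vdiffAt_extend v
        have hw := vdiffAt_extend w
        have h1 := g.koszul_formula (hf.smul_section hY) hv hw
        have h2 := g.koszul_formula hY hv hw
        rw [g.koszul_smul hf hY hv hw] at h1
        simp only [FiberBundle.extend_apply_self] at h1 h2
        simp [h1, h2]
        ring }

theorem leviCivita_torsion_free (hX : VDiffAt X x) (hY : VDiffAt Y x) :
    g.leviCivita Y x (X x) - g.leviCivita X x (Y x) = mlieBracket (𝓡 4) X Y x := by
  refine g.ext_val fun w ↦ ?_
  have hw := vdiffAt_extend w
  have h1 := g.koszul_formula hY hX hw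
  have h2 := g.koszul_formula hX hY hw
  simp only [FiberBundle.extend_apply_self] at h1 h2
  simp only [map_sub, sub_apply]
  change g.val x (g.covAux Y x (X x)) w - g.val x (g.covAux X x (Y x)) w = _
  rw [h1, h2, koszul, koszul, mlieBracket_swap_apply (V := Y) (W := X)]
  have : (fun p ↦ g.val p (X p) (Y p)) = fun p ↦ g.val p (Y p) (X p) := by
    ext p; rw [g.symm]
  rw [this]
  simp
  ring

theorem leviCivita_metric (hX : VDiffAt X x) (hY : VDiffAt Y x) (v : TangentSpace (𝓡 4) x) :
    mvfderiv (𝓡 4) (fun p ↦ g.val p (X p) (Y p)) x v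
      = g.val x (g.leviCivita X x v) (Y x) + g.val x (X x) (g.leviCivita Y x v) := by
  have hv := vdiffAt_extend v
  have h1 := g.koszul_formula hX hv hY
  have h2 := g.koszul_formula hY hv hX
  simp only [FiberBundle.extend_apply_self] at h1 h2
  change _ = g.val x (g.covAux X x v) (Y x) + g.val x (X x) (g.covAux Y x v)
  rw [g.symm x (X x), h1, h2, koszul, koszul, mlieBracket_swap_apply (V := Y) (W := X)]
  have : (fun p ↦ g.val p (Y p) (X p)) = fun p ↦ g.val p (X p) (Y p) := by
    ext p; rw [g.symm]
  rw [this]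
  simp
  ring

/-- The acceleration `u̇ = ∇_u u` of the vector field `u`. -/
def accel (u : VField M) : VField M := fun x ↦ g.leviCivita u x (u x)

/-- `η = g(u̇, u̇)`. -/
def eta (u : VField M) (x : M) : ℝ := g.val x (g.accel u x) (g.accel u x)

/-- The divergence `∇^k X_k` of a vector field, the trace of `v ↦ ∇_v X`. -/
def divergence (X : VField M) (x : M) : ℝ :=
  LinearMap.trace ℝ (TangentSpace (𝓡 4) x) (g.leviCivita X x).toLinearMap

/-- `g` is static with velocity `u`: a smooth time-like unit vector field with
`∇_j u_k = - u_j u̇_k`, whose acceleration is closed, `∇_j u̇_k = ∇_k u̇_j`, and space-like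
(`η > 0`). -/
structure IsStatic (u : VField M) : Prop where
  smooth : VSmooth u
  unit : ∀ x, g.val x (u x) (u x) = -1
  grad : ∀ (x : M) (v w : TangentSpace (𝓡 4) x),
    g.val x (g.leviCivita u x v) w = -(g.val x (u x) v * g.val x (g.accel u x) w)
  closed : ∀ (x : M) (v w : TangentSpace (𝓡 4) x),
    g.val x (g.leviCivita (g.accel u) x v) w = g.val x (g.leviCivita (g.accel u) x w) v
  eta_pos : ∀ x, 0 < g.eta u x

/-- At every point `y`, `z` are orthonormal and orthogonal to `u` and `u̇`. -/
structure IsTransversePair (u y z : VField M) : Prop where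
  y_unit : ∀ x, g.val x (y x) (y x) = 1
  z_unit : ∀ x, g.val x (z x) (z x) = 1
  y_orth_z : ∀ x, g.val x (y x) (z x) = 0
  y_orth_u : ∀ x, g.val x (y x) (u x) = 0
  z_orth_u : ∀ x, g.val x (z x) (u x) = 0
  y_orth_accel : ∀ x, g.val x (y x) (g.accel u x) = 0
  z_orth_accel : ∀ x, g.val x (z x) (g.accel u x) = 0

/-- The antisymmetric tensor `X_j Y_k - Y_j X_k`. -/
def wedge (X Y : VField M) (x : M) :
    TangentSpace (𝓡 4) x →L[ℝ] TangentSpace (𝓡 4) x →L[ℝ] ℝ :=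
  (g.val x (X x)).smulRight (g.val x (Y x)) - (g.val x (Y x)).smulRight (g.val x (X x))

theorem wedge_apply (v w : TangentSpace (𝓡 4) x) :
    g.wedge X Y x v w
      = g.val x (X x) v * g.val x (Y x) w - g.val x (Y x) v * g.val x (X x) w := by
  simp [wedge]

/-- `F_{jk} = (𝔼/√η) (u_j u̇_k - u̇_j u_k) + 𝔹 (y_j z_k - z_j y_k)`. -/
def fieldTensor (u y z : VField M) (E B : M → ℝ) (x : M) :
    TangentSpace (𝓡 4) x →L[ℝ] TangentSpace (𝓡 4) x →L[ℝ] ℝ :=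
  (E x / √(g.eta u x)) • g.wedge u (g.accel u) x + B x • g.wedge y z x

/-- The covariant derivative `(∇_X F)(Y, Z)` of a covariant 2-tensor field `F`, at `x`. -/
def covTensor (F : ∀ x : M, TangentSpace (𝓡 4) x →L[ℝ] TangentSpace (𝓡 4) x →L[ℝ] ℝ)
    (X Y Z : VField M) (x : M) : ℝ :=
  mvfderiv (𝓡 4) (fun p ↦ F p (Y p) (Z p)) x (X x)
    - F x (g.leviCivita Y x (X x)) (Z x) - F x (Y x) (g.leviCivita Z x (X x))

/-- `∇_j F_{kl} + ∇_k F_{lj} + ∇_l F_{jk} = 0`, tested on vector fields. -/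
def IsFaraday (F : ∀ x : M, TangentSpace (𝓡 4) x →L[ℝ] TangentSpace (𝓡 4) x →L[ℝ] ℝ) : Prop :=
  ∀ (x : M) (X Y Z : VField M), VDiffAt X x → VDiffAt Y x → VDiffAt Z x →
    g.covTensor F X Y Z x + g.covTensor F Y Z X x + g.covTensor F Z X Y x = 0

end LorentzMetric

end StaticFaraday

end

/-! Put φ = 𝔼/√η and ω = y∧z, and read vector fields as 1-forms by lowering indices, so that F = φ
u∧u̇ + 𝔹 ω and the Faraday equation says dF = 0.

Since ∇u = -u⊗u̇ and ∇u̇ is symmetric, u∧u̇ is closed, and the electric part contributes dφ∧u∧u̇.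
The form ω is the area form of the planes orthogonal to u and u̇. Its derivative is governed by ∇u̇
alone, because ∇u points along u̇, which ω annihilates. This gives dω = (τ/η) u̇∧ω, where τ is the
trace of ∇u̇ over the plane of y and z; by `divergence_accel`, τ = ∇^k u̇_k - η - u̇(η)/(2η). As
u(𝔹) = 0, also d𝔹∧ω = (u̇(𝔹)/η) u̇∧ω. Altogether dF = dφ∧u∧u̇ + η⁻¹ (u̇(𝔹) + τ𝔹) u̇∧ω, which is
`eta_mul_cyclic_covTensor_fieldTensor`. The two terms are detected by different triples of frame
vectors, so they vanish separately. The first vanishes iff dφ kills y and z, which together with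
u(φ) = 0 means dφ = ϰ u̇; the second is condition 2.

The fields y and z need not be differentiable: only ω is smooth. Hence ∇ω is computed in
`eta_mul_covTensor_wedge` by differentiating the Gram identity `wedge_mul_wedge`, which writes ω⊗ω
through g, u and u̇.

Finally ϰ = u̇(φ)/η, which is smooth, and ϰ̇ = 0 follows by applying the commutator [u, u̇] to φ
(`mvfderiv_mlieBracket`). -/

noncomputable section

namespace StaticFaraday

variable {M : Type*} [TopologicalSpace M] [ChartedSpace (EuclideanSpace ℝ (Fin 4)) M]
  [IsManifold (𝓡 4) ∞ M]

/-- The vector field `X` is smooth at `x`. -/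
abbrev VSmoothAt (X : VField M) (x : M) : Prop :=
  ContMDiffAt (𝓡 4) ((𝓡 4).prod 𝓘(ℝ, EuclideanSpace ℝ (Fin 4))) ∞
    (fun p ↦ TotalSpace.mk' (EuclideanSpace ℝ (Fin 4)) p (X p)) x

theorem VSmoothAt.vdiffAt {X : VField M} {x : M} (hX : VSmoothAt X x) : VDiffAt X x :=
  ContMDiffAt.mdifferentiableAt hX (by simp)

/-- The derivative of a smooth function along a smooth vector field is smooth. -/
theorem contMDiffAt_mvfderiv_apply {f : M → ℝ} {X : VField M} {x : M}
    (hf : ContMDiffAt (𝓡 4) 𝓘(ℝ) ∞ f x) (hX : VSmoothAt X x) :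
    ContMDiffAt (𝓡 4) 𝓘(ℝ) ∞ (fun p ↦ mvfderiv (𝓡 4) f p (X p)) x := by
  have h1 := hf.mfderiv_const (m := ∞) (by simp)
  have h2 := ContMDiffAt.clm_apply_of_inCoordinates (b₁ := fun p : M ↦ p) (b₂ := f) h1 hX hf
  rw [Bundle.contMDiffAt_totalSpace] at h2
  have h3 := h2.2
  simp only [trivializationAt_model_space_apply] at h3
  exact h3

/-! ### Lie brackets as commutators of derivations -/

theorem minSmoothness_natCast_le_infty (n : ℕ) : minSmoothness ℝ n ≤ (∞ : WithTop ℕ∞) := by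
  rw [minSmoothness_of_isRCLikeNormedField]
  exact WithTop.coe_le_coe.2 (le_top (a := (n : ℕ∞)))

theorem isManifold_minSmoothness (n : ℕ) : IsManifold (𝓡 4) (minSmoothness ℝ n) M :=
  .of_le (minSmoothness_natCast_le_infty n)

theorem contMDiffAt_mlieBracket {X Y : VField M} {x : M} (hX : VSmoothAt X x)
    (hY : VSmoothAt Y x) : VSmoothAt (mlieBracket (𝓡 4) X Y) x := by
  have : IsManifold (𝓡 4) (((⊤ : ℕ∞) : WithTop ℕ∞) + 1) M := ‹IsManifold (𝓡 4) ∞ M›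
  have : IsManifold (𝓡 4) (minSmoothness ℝ 2) M := isManifold_minSmoothness 2
  exact ContMDiffAt.mlieBracket_vectorField (m := ⊤) (n := ⊤) hX hY (by simp)

/-- `X (Y f) - Y (X f) = [X, Y] f`, at a point where some smooth vector field does not vanish. -/
theorem mvfderiv_mlieBracket {f : M → ℝ} {X Y W : VField M} {x : M}
    (hf : ContMDiff (𝓡 4) 𝓘(ℝ) ∞ f) (hX : VSmooth X) (hY : VSmooth Y) (hW : VSmooth W)
    (hW0 : W x ≠ 0) :
    mvfderiv (𝓡 4) (fun p ↦ mvfderiv (𝓡 4) f p (Y p)) x (X x)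
      - mvfderiv (𝓡 4) (fun p ↦ mvfderiv (𝓡 4) f p (X p)) x (Y x)
      = mvfderiv (𝓡 4) f x (mlieBracket (𝓡 4) X Y x) := by
  have : IsManifold (𝓡 4) (minSmoothness ℝ 3) M := isManifold_minSmoothness 3
  have le2 : minSmoothness ℝ 2 ≤ (∞ : WithTop ℕ∞) := minSmoothness_natCast_le_infty 2
  have hfd : ∀ p, MDifferentiableAt (𝓡 4) 𝓘(ℝ) f p := fun p ↦
    (hf p).mdifferentiableAt (by simp)
  have hWd : ∀ p, VDiffAt W p := fun p ↦ VSmoothAt.vdiffAt (hW p)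
  -- The Jacobi identity is used for X, Y, W and for X, Y, f • W. Expanding the second by the
  -- Leibniz rule and removing the first leaves the desired identity as the coefficient of W x.
  have jac1 := leibniz_identity_mlieBracket_apply ((hX x).of_le le2) ((hY x).of_le le2)
    ((hW x).of_le le2)
  have hfW : VSmooth (f • W) := hf.smul_section hW
  have jac2 := leibniz_identity_mlieBracket_apply ((hX x).of_le le2) ((hY x).of_le le2)
    ((hfW x).of_le le2)
  have step (V : VField M) : mlieBracket (𝓡 4) V (f • W)
      = (fun p ↦ mvfderiv (𝓡 4) f p (V p)) • W + f • mlieBracket (𝓡 4) V W := by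
    ext1 p
    exact mlieBracket_smul_right (hfd p) (hWd p)
  have key {V U : VField M} (hV : VSmooth V) (hU : VSmooth U) :
      mlieBracket (𝓡 4) V (mlieBracket (𝓡 4) U (f • W)) x
        = mvfderiv (𝓡 4) (fun p ↦ mvfderiv (𝓡 4) f p (U p)) x (V x) • W x
          + mvfderiv (𝓡 4) f x (U x) • mlieBracket (𝓡 4) V W x
          + (mvfderiv (𝓡 4) f x (V x) • mlieBracket (𝓡 4) U W x
            + f x • mlieBracket (𝓡 4) V (mlieBracket (𝓡 4) U W) x) := by
    have hd : MDifferentiableAt (𝓡 4) 𝓘(ℝ) (fun p ↦ mvfderiv (𝓡 4) f p (U p)) x :=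
      (contMDiffAt_mvfderiv_apply (hf x) (hU x)).mdifferentiableAt (by simp)
    have hb : VDiffAt (mlieBracket (𝓡 4) U W) x :=
      (contMDiffAt_mlieBracket (hU x) (hW x)).vdiffAt
    rw [step U, mlieBracket_add_right (hd.smul_section (hWd x)) ((hfd x).smul_section hb),
      mlieBracket_smul_right hd (hWd x), mlieBracket_smul_right (hfd x) hb]
  rw [key hX hY, key hY hX, mlieBracket_smul_right (hfd x) (hWd x), jac1] at jac2
  have h0 : (mvfderiv (𝓡 4) (fun p ↦ mvfderiv (𝓡 4) f p (Y p)) x (X x)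
      - mvfderiv (𝓡 4) (fun p ↦ mvfderiv (𝓡 4) f p (X p)) x (Y x)
      - mvfderiv (𝓡 4) f x (mlieBracket (𝓡 4) X Y x)) • W x = 0 := by
    simp only [sub_smul, smul_add] at jac2 ⊢
    rw [← sub_eq_zero] at jac2
    rw [← jac2]
    abel
  exact sub_eq_zero.1 ((smul_eq_zero.1 h0).resolve_right hW0)

/-! ### Smoothness of the Levi-Civita derivative -/

namespace LorentzMetric

variable (g : LorentzMetric M) {x : M}

theorem contMDiffAt_val {X Y : VField M} (hX : VSmoothAt X x) (hY : VSmoothAt Y x) :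
    ContMDiffAt (𝓡 4) 𝓘(ℝ) ∞ (fun p ↦ g.val p (X p) (Y p)) x := by
  have h2 := ContMDiffAt.clm_bundle_apply₂ (b := fun p : M ↦ p)
    (E₃ := Bundle.Trivial M ℝ) (F₃ := ℝ) (g.smooth x) hX hY
  rw [Bundle.contMDiffAt_section] at h2
  exact h2

/-- A vector field is smooth if its products with all local smooth vector fields are smooth. -/
theorem vsmoothAt_of_val {X : VField M}
    (h : ∀ (Z : VField M), (∀ᶠ p in 𝓝 x, VSmoothAt Z p) →
      ContMDiffAt (𝓡 4) 𝓘(ℝ) ∞ (fun p ↦ g.val p (X p) (Z p)) x) : VSmoothAt X x := by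
  set e := trivializationAt (EuclideanSpace ℝ (Fin 4))
    (TangentSpace (𝓡 4) : M → Type _) x
  have hxe : x ∈ e.baseSet := FiberBundle.mem_baseSet_trivializationAt' x
  have hnhds : e.baseSet ∈ 𝓝 x := e.open_baseSet.mem_nhds hxe
  let b := (EuclideanSpace.basisFun (Fin 4) ℝ).toBasis
  have hfr : ∀ i, ∀ p ∈ e.baseSet, VSmoothAt (e.localFrame b i) p := fun i p hp ↦
    contMDiffAt_localFrame_of_mem ∞ e b i hp
  -- The frame coefficients `c` of X solve the linear system G c = β, where G is the Gram matrix of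
  -- a local frame and β is smooth by hypothesis. Nondegeneracy of g makes G invertible, and
  -- Cramer's rule then writes c as a quotient of smooth functions.
  let G : M → Matrix (Fin 4) (Fin 4) ℝ := fun p ↦
    Matrix.of fun i j ↦ g.val p (e.localFrame b j p) (e.localFrame b i p)
  let β : M → Fin 4 → ℝ := fun p i ↦ g.val p (X p) (e.localFrame b i p)
  let c : M → Fin 4 → ℝ := fun p i ↦ e.localFrameCoeff (𝓡 4) b i p (X p)
  have hβ : ∀ i, ContMDiffAt (𝓡 4) 𝓘(ℝ) ∞ (fun p ↦ β p i) x := fun i ↦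
    h _ (Filter.eventually_of_mem hnhds (hfr i))
  have hG : ∀ i j, ContMDiffAt (𝓡 4) 𝓘(ℝ) ∞ (fun p ↦ G p i j) x := fun i j ↦
    g.contMDiffAt_val (hfr j x hxe) (hfr i x hxe)
  have hdetS {A : M → Matrix (Fin 4) (Fin 4) ℝ}
      (hA : ∀ i j, ContMDiffAt (𝓡 4) 𝓘(ℝ) ∞ (fun p ↦ A p i j) x) :
      ContMDiffAt (𝓡 4) 𝓘(ℝ) ∞ (fun p ↦ (A p).det) x := by
    simp only [Matrix.det_apply']
    exact contMDiffAt_finsetSum fun σ _ ↦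
      contMDiffAt_const.mul (contMDiffAt_finsetProd fun i _ ↦ hA _ _)
  have hGc : ∀ p ∈ e.baseSet, (G p).mulVec (c p) = β p := by
    intro p hp
    ext i
    simp only [β]
    conv_rhs => rw [e.eq_sum_localFrameCoeff_smul (I := 𝓡 4) (b := b) (s := X) hp]
    simp [Matrix.mulVec, dotProduct, G, c, mul_comm]
  have hdet : ∀ p ∈ e.baseSet, (G p).det ≠ 0 := by
    intro p hp h0
    obtain ⟨v, hv, hv0⟩ := Matrix.exists_mulVec_eq_zero_iff.2 h0
    apply hv
    have h1 : ∑ j, v j • e.basisAt b hp j = 0 := by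
      refine g.nondegenerate fun w ↦ ?_
      rw [← (e.basisAt b hp).sum_repr w]
      simp only [map_sum, map_smul]
      refine Finset.sum_eq_zero fun i _ ↦ ?_
      have := congrFun hv0 i
      simp only [Matrix.mulVec, dotProduct, G, Matrix.of_apply,
        e.localFrame_apply_of_mem_baseSet b hp, Pi.zero_apply] at this
      simp only [sum_apply, smul_apply, smul_eq_mul]
      rw [show (∑ j, v j * g.val p (e.basisAt b hp j) (e.basisAt b hp i)) = 0 by
        rw [← this]; exact Finset.sum_congr rfl fun j _ ↦ mul_comm _ _, mul_zero]
    ext j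
    exact Fintype.linearIndependent_iff.1 (e.basisAt b hp).linearIndependent v h1 j
  refine (contMDiffAt_iff_localFrameCoeff b hxe).2 fun i ↦ ?_
  have hq : ContMDiffAt (𝓡 4) 𝓘(ℝ) ∞ (fun p ↦ ((G p).updateCol i (β p)).det / (G p).det) x := by
    refine ContMDiffAt.div₀ (hdetS fun k l ↦ ?_) (hdetS hG) (hdet x hxe)
    by_cases hl : l = i
    · subst hl; simpa using hβ k
    · simpa [hl] using hG k l
  refine hq.congr_of_eventuallyEq (Filter.eventually_of_mem hnhds fun p hp ↦ ?_)
  rw [eq_div_iff (hdet p hp)]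
  change c p i * _ = _
  rw [← Matrix.cramer_apply, Matrix.cramer_eq_adjugate_mulVec, ← hGc p hp, Matrix.mulVec_mulVec,
    Matrix.adjugate_mul, Matrix.smul_mulVec, Matrix.one_mulVec]
  simp [mul_comm]

/-- The covariant derivative of a smooth vector field along a smooth vector field is smooth. -/
theorem vsmoothAt_leviCivita {X Y : VField M} (hX : VSmooth X) (hY : VSmooth Y) :
    VSmoothAt (fun p ↦ g.leviCivita Y p (X p)) x := by
  refine g.vsmoothAt_of_val fun Z hZ ↦ ?_
  have hk : ContMDiffAt (𝓡 4) 𝓘(ℝ) ∞ (fun p ↦ 1 / 2 * g.koszul Y X Z p) x := by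
    have hZx := hZ.self_of_nhds
    simp only [koszul]
    refine contMDiffAt_const.mul (((((?_ : ContMDiffAt _ _ _ _ _).add ?_).sub ?_).add ?_).sub ?_
      |>.sub ?_)
    · exact contMDiffAt_mvfderiv_apply (g.contMDiffAt_val (hY x) hZx) (hX x)
    · exact contMDiffAt_mvfderiv_apply (g.contMDiffAt_val (hX x) hZx) (hY x)
    · exact contMDiffAt_mvfderiv_apply (g.contMDiffAt_val (hX x) (hY x)) hZx
    · exact g.contMDiffAt_val (contMDiffAt_mlieBracket (hX x) (hY x)) hZx
    · exact g.contMDiffAt_val (contMDiffAt_mlieBracket (hX x) hZx) (hY x)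
    · exact g.contMDiffAt_val (contMDiffAt_mlieBracket (hY x) hZx) (hX x)
  refine hk.congr_of_eventuallyEq (hZ.mono fun p hp ↦ ?_)
  exact g.koszul_formula (VSmoothAt.vdiffAt (hY p)) (VSmoothAt.vdiffAt (hX p)) hp.vdiffAt

end LorentzMetric

/-! ### Pointwise rules for derivatives of scalar fields -/

theorem mdiffAt_add {f h : M → ℝ} {x : M} (hf : MDifferentiableAt (𝓡 4) 𝓘(ℝ) f x)
    (hh : MDifferentiableAt (𝓡 4) 𝓘(ℝ) h x) :
    MDifferentiableAt (𝓡 4) 𝓘(ℝ) (fun p ↦ f p + h p) x := hf.add hh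

theorem mdiffAt_mul {f h : M → ℝ} {x : M} (hf : MDifferentiableAt (𝓡 4) 𝓘(ℝ) f x)
    (hh : MDifferentiableAt (𝓡 4) 𝓘(ℝ) h x) :
    MDifferentiableAt (𝓡 4) 𝓘(ℝ) (fun p ↦ f p * h p) x := hf.mul hh

theorem mvfderiv_add_apply {f h : M → ℝ} {x : M} (hf : MDifferentiableAt (𝓡 4) 𝓘(ℝ) f x)
    (hh : MDifferentiableAt (𝓡 4) 𝓘(ℝ) h x) (v : TangentSpace (𝓡 4) x) :
    mvfderiv (𝓡 4) (fun p ↦ f p + h p) x v = mvfderiv (𝓡 4) f x v + mvfderiv (𝓡 4) h x v :=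
  congr($(mvfderiv_add hf hh) v)

theorem mvfderiv_sub_apply {f h : M → ℝ} {x : M} (hf : MDifferentiableAt (𝓡 4) 𝓘(ℝ) f x)
    (hh : MDifferentiableAt (𝓡 4) 𝓘(ℝ) h x) (v : TangentSpace (𝓡 4) x) :
    mvfderiv (𝓡 4) (fun p ↦ f p - h p) x v = mvfderiv (𝓡 4) f x v - mvfderiv (𝓡 4) h x v :=
  congr($(mvfderiv_sub hf hh) v)

theorem mvfderiv_mul_apply {f h : M → ℝ} {x : M} (hf : MDifferentiableAt (𝓡 4) 𝓘(ℝ) f x)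
    (hh : MDifferentiableAt (𝓡 4) 𝓘(ℝ) h x) (v : TangentSpace (𝓡 4) x) :
    mvfderiv (𝓡 4) (fun p ↦ f p * h p) x v
      = f x * mvfderiv (𝓡 4) h x v + h x * mvfderiv (𝓡 4) f x v :=
  congr($(mvfderiv_mul hf hh) v)

namespace LorentzMetric

variable {g : LorentzMetric M} {u y z : VField M} {x : M}

/-! ### Identities for the velocity and acceleration of a static spacetime -/

namespace IsStatic

variable (hu : g.IsStatic u)
include hu

theorem vdiffAt (x : M) : VDiffAt u x := VSmoothAt.vdiffAt (hu.smooth x)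

theorem accel_smooth : VSmooth (g.accel u) := fun _ ↦ g.vsmoothAt_leviCivita hu.smooth hu.smooth

theorem accel_vdiffAt (x : M) : VDiffAt (g.accel u) x := VSmoothAt.vdiffAt (hu.accel_smooth x)

theorem eta_smooth : ContMDiff (𝓡 4) 𝓘(ℝ) ∞ (g.eta u) := fun x ↦
  g.contMDiffAt_val (hu.accel_smooth x) (hu.accel_smooth x)

theorem eta_mdiffAt (x : M) : MDifferentiableAt (𝓡 4) 𝓘(ℝ) (g.eta u) x :=
  (hu.eta_smooth x).mdifferentiableAt (by simp)

/-- Differentiate g(u, u) = -1 along u. -/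
theorem val_accel (x : M) : g.val x (u x) (g.accel u x) = 0 := by
  have h := g.leviCivita_metric (hu.vdiffAt x) (hu.vdiffAt x) (u x)
  simp only [hu.unit, mvfderiv_const] at h
  rw [g.symm x (g.leviCivita u x (u x)) (u x)] at h
  simp only [zero_apply] at h
  change g.val x (u x) (g.leviCivita u x (u x)) = 0
  linarith

theorem val_accel' (x : M) : g.val x (g.accel u x) (u x) = 0 := by
  rw [g.symm, hu.val_accel]

theorem mvfderiv_eta (v : TangentSpace (𝓡 4) x) :
    mvfderiv (𝓡 4) (g.eta u) x v
      = 2 * g.val x (g.leviCivita (g.accel u) x v) (g.accel u x) := by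
  have h := g.leviCivita_metric (hu.accel_vdiffAt x) (hu.accel_vdiffAt x) v
  rw [g.symm x (g.accel u x)] at h
  change mvfderiv (𝓡 4) (fun p ↦ g.val p (g.accel u p) (g.accel u p)) x v = _
  linarith

/-- Differentiate g(u̇, u) = 0 and insert ∇u = -u⊗u̇. -/
theorem val_leviCivita_accel (v : TangentSpace (𝓡 4) x) :
    g.val x (g.leviCivita (g.accel u) x v) (u x) = g.eta u x * g.val x (u x) v := by
  have h := g.leviCivita_metric (hu.accel_vdiffAt x) (hu.vdiffAt x) v
  simp only [hu.val_accel', mvfderiv_const, zero_apply] at h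
  rw [g.symm x (g.accel u x), hu.grad] at h
  simp only [eta]
  linarith

/-- By symmetry of ∇u̇, half of u(η) is g(∇_u u̇, u̇) = g(∇_u̇ u̇, u) = η g(u, u̇) = 0. -/
theorem mvfderiv_eta_self : mvfderiv (𝓡 4) (g.eta u) x (u x) = 0 := by
  rw [hu.mvfderiv_eta, hu.closed, hu.val_leviCivita_accel, hu.val_accel]
  simp

theorem sqrt_eta_smooth : ContMDiff (𝓡 4) 𝓘(ℝ) ∞ (fun p ↦ √(g.eta u p)) := fun x ↦
  (Real.contDiffAt_sqrt (hu.eta_pos x).ne').contMDiffAt.comp x (hu.eta_smooth x)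

theorem sqrt_eta_pos (x : M) : 0 < √(g.eta u x) := Real.sqrt_pos.2 (hu.eta_pos x)

theorem div_sqrt_eta_smooth {E : M → ℝ} (hE : ContMDiff (𝓡 4) 𝓘(ℝ) ∞ E) :
    ContMDiff (𝓡 4) 𝓘(ℝ) ∞ (fun p ↦ E p / √(g.eta u p)) :=
  hE.div₀ hu.sqrt_eta_smooth fun p ↦ (hu.sqrt_eta_pos p).ne'

theorem mvfderiv_div_sqrt_eta {E : M → ℝ} (hE : ContMDiff (𝓡 4) 𝓘(ℝ) ∞ E)
    (hE_dot : mvfderiv (𝓡 4) E x (u x) = 0) :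
    mvfderiv (𝓡 4) (fun p ↦ E p / √(g.eta u p)) x (u x) = 0 := by
  have hs := (hu.sqrt_eta_smooth x).mdifferentiableAt (by simp)
  have hp := (hu.div_sqrt_eta_smooth hE x).mdifferentiableAt (by simp)
  -- The product rule is applied to √η·√η = η and to (𝔼/√η)·√η = 𝔼, so neither the root nor the
  -- quotient has to be differentiated explicitly.
  have h1 := mvfderiv_mul_apply hs hs (u x)
  have h2 := mvfderiv_mul_apply hp hs (u x)
  simp only [Real.mul_self_sqrt (hu.eta_pos _).le] at h1
  simp only [div_mul_cancel₀ _ (hu.sqrt_eta_pos _).ne'] at h2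
  rw [hE_dot] at h2
  have h3 : mvfderiv (𝓡 4) (g.eta u) x (u x) = _ := h1
  rw [hu.mvfderiv_eta_self] at h3
  have h0 := hu.sqrt_eta_pos x
  have h4 : mvfderiv (𝓡 4) (fun p ↦ √(g.eta u p)) x (u x) = 0 := by
    apply (mul_eq_zero.1 (_ : √(g.eta u x) * _ = 0)).resolve_left h0.ne'
    linarith
  rw [h4, mul_zero, zero_add] at h2
  exact (mul_eq_zero.1 h2.symm).resolve_left h0.ne'

end IsStatic

/-! ### The orthogonal frame u, u̇, y, z -/

section Frame

variable (hu : g.IsStatic u) (hyz : g.IsTransversePair u y z)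
include hu hyz

/-- The vectors `u`, `u̇`, `y`, `z` form a basis of each tangent space. -/
theorem exists_basis (x : M) : ∃ b : Module.Basis (Fin 4) ℝ (TangentSpace (𝓡 4) x),
    (b 0 = u x ∧ b 1 = g.accel u x ∧ b 2 = y x ∧ b 3 = z x) ∧
    ∀ v, b.repr v 0 = -g.val x (u x) v ∧ b.repr v 1 = g.val x (g.accel u x) v / g.eta u x ∧
      b.repr v 2 = g.val x (y x) v ∧ b.repr v 3 = g.val x (z x) v := by
  have hη := hu.eta_pos x
  have haa : g.val x (g.accel u x) (g.accel u x) = g.eta u x := rfl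
  -- Pairing with an orthogonal frame reads off coefficients. For v = 0 this gives linear
  -- independence; for the basis expansion of v it gives the coordinates.
  have prod (c : Fin 4 → ℝ) (v : TangentSpace (𝓡 4) x)
      (hv : v = c 0 • u x + c 1 • g.accel u x + c 2 • y x + c 3 • z x) :
      c 0 = -g.val x (u x) v ∧ c 1 = g.val x (g.accel u x) v / g.eta u x ∧
        c 2 = g.val x (y x) v ∧ c 3 = g.val x (z x) v := by
    subst hv
    simp only [map_add, map_smul, smul_eq_mul, hu.unit, hu.val_accel, hu.val_accel', haa,
      hyz.y_unit, hyz.z_unit, hyz.y_orth_z, hyz.y_orth_u, hyz.z_orth_u, hyz.y_orth_accel,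
      hyz.z_orth_accel, g.symm x (u x) (y x), g.symm x (u x) (z x), g.symm x (z x) (y x),
      g.symm x (g.accel u x) (y x), g.symm x (g.accel u x) (z x)]
    refine ⟨by ring, ?_, by ring, by ring⟩
    field_simp
    ring
  let e : Fin 4 → TangentSpace (𝓡 4) x := ![u x, g.accel u x, y x, z x]
  have hli : LinearIndependent ℝ e := by
    rw [Fintype.linearIndependent_iff]
    intro c hc
    obtain ⟨h0, h1, h2, h3⟩ := prod c 0 (by rw [← hc]; simp [e, Fin.sum_univ_four])
    simp only [map_zero, neg_zero, zero_div] at h0 h1 h2 h3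
    intro i
    fin_cases i
    exacts [h0, h1, h2, h3]
  have hcard : Fintype.card (Fin 4) = Module.finrank ℝ (TangentSpace (𝓡 4) x) := by
    change _ = Module.finrank ℝ (EuclideanSpace ℝ (Fin 4))
    simp
  let b := basisOfLinearIndependentOfCardEqFinrank hli hcard
  have hb : ⇑b = e := coe_basisOfLinearIndependentOfCardEqFinrank hli hcard
  refine ⟨b, ⟨by rw [hb]; rfl, by rw [hb]; rfl, by rw [hb]; rfl, by rw [hb]; rfl⟩, fun v ↦ ?_⟩
  refine prod (b.repr v) v ?_
  conv_lhs => rw [← b.sum_repr v]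
  simp [Fin.sum_univ_four, hb, e]

theorem frame_expansion (v : TangentSpace (𝓡 4) x) :
    v = (-g.val x (u x) v) • u x + (g.val x (g.accel u x) v / g.eta u x) • g.accel u x
      + g.val x (y x) v • y x + g.val x (z x) v • z x := by
  obtain ⟨b, ⟨b0, b1, b2, b3⟩, hb⟩ := exists_basis hu hyz x
  obtain ⟨h0, h1, h2, h3⟩ := hb v
  conv_lhs => rw [← b.sum_repr v, Fin.sum_univ_four, b0, b1, b2, b3, h0, h1, h2, h3]

theorem val_eq (v w : TangentSpace (𝓡 4) x) :
    g.val x v w = -(g.val x (u x) v * g.val x (u x) w)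
      + g.val x (g.accel u x) v * g.val x (g.accel u x) w / g.eta u x
      + g.val x (y x) v * g.val x (y x) w + g.val x (z x) v * g.val x (z x) w := by
  conv_lhs => rw [frame_expansion hu hyz v]
  simp only [map_add, map_smul, add_apply, smul_apply, smul_eq_mul]
  ring

/-- The trace is the sum of diagonal entries in the frame: u contributes -g(u, ∇_u u̇) = η, and u̇
contributes g(u̇, ∇_u̇ u̇)/η = u̇(η)/(2η). -/
theorem divergence_accel (x : M) : g.divergence (g.accel u) x
    = g.eta u x + mvfderiv (𝓡 4) (g.eta u) x (g.accel u x) / (2 * g.eta u x)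
      + g.val x (g.leviCivita (g.accel u) x (y x)) (y x)
      + g.val x (g.leviCivita (g.accel u) x (z x)) (z x) := by
  obtain ⟨b, ⟨b0, b1, b2, b3⟩, hb⟩ := exists_basis hu hyz x
  have hη := hu.eta_pos x
  rw [divergence, LinearMap.trace_eq_matrix_trace ℝ b, Matrix.trace, Fin.sum_univ_four]
  simp only [Matrix.diag_apply, LinearMap.toMatrix_apply, b0, b1, b2, b3, hb,
    ContinuousLinearMap.coe_coe]
  rw [g.symm x (u x), hu.val_leviCivita_accel, hu.unit, hu.mvfderiv_eta, g.symm x (g.accel u x),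
    g.symm x (y x), g.symm x (z x)]
  field_simp

end Frame

/-! ### Leibniz rules for covariant derivatives of 2-tensors -/

section CovTensor

variable {T S : ∀ x : M, TangentSpace (𝓡 4) x →L[ℝ] TangentSpace (𝓡 4) x →L[ℝ] ℝ}
  {X Y Z : VField M} {f : M → ℝ}

theorem _root_.StaticFaraday.TensorSmooth.mdiffAt (hT : TensorSmooth T) (hY : VDiffAt Y x)
    (hZ : VDiffAt Z x) : MDifferentiableAt (𝓡 4) 𝓘(ℝ) (fun p ↦ T p (Y p) (Z p)) x := by
  have h1 := (ContMDiff.contMDiffAt (x := x) hT).mdifferentiableAt (by simp)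
  have h2 := MDifferentiableAt.clm_bundle_apply₂ (b := fun p : M ↦ p)
    (E₃ := Bundle.Trivial M ℝ) (F₃ := ℝ) h1 hY hZ
  rw [mdifferentiableAt_section] at h2
  exact h2

theorem wedge_mdiffAt {U V : VField M} (hU : VDiffAt U x) (hV : VDiffAt V x) (hY : VDiffAt Y x)
    (hZ : VDiffAt Z x) :
    MDifferentiableAt (𝓡 4) 𝓘(ℝ) (fun p ↦ g.wedge U V p (Y p) (Z p)) x := by
  simp only [wedge_apply]
  exact ((g.mdiffAt hU hY).mul (g.mdiffAt hV hZ)).sub ((g.mdiffAt hV hY).mul (g.mdiffAt hU hZ))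

theorem covTensor_add
    (hT : MDifferentiableAt (𝓡 4) 𝓘(ℝ) (fun p ↦ T p (Y p) (Z p)) x)
    (hS : MDifferentiableAt (𝓡 4) 𝓘(ℝ) (fun p ↦ S p (Y p) (Z p)) x) :
    g.covTensor (fun p ↦ T p + S p) X Y Z x = g.covTensor T X Y Z x + g.covTensor S X Y Z x := by
  simp only [covTensor, add_apply, mvfderiv_add_apply hT hS]
  ring

theorem covTensor_smul (hf : MDifferentiableAt (𝓡 4) 𝓘(ℝ) f x)
    (hT : MDifferentiableAt (𝓡 4) 𝓘(ℝ) (fun p ↦ T p (Y p) (Z p)) x) :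
    g.covTensor (fun p ↦ f p • T p) X Y Z x
      = mvfderiv (𝓡 4) f x (X x) * T x (Y x) (Z x) + f x * g.covTensor T X Y Z x := by
  simp only [covTensor, smul_apply, smul_eq_mul, mvfderiv_mul_apply hf hT]
  ring

theorem covTensor_wedge {U V : VField M} (hU : VDiffAt U x) (hV : VDiffAt V x)
    (hY : VDiffAt Y x) (hZ : VDiffAt Z x) :
    g.covTensor (g.wedge U V) X Y Z x
      = g.val x (g.leviCivita U x (X x)) (Y x) * g.val x (V x) (Z x)
        + g.val x (U x) (Y x) * g.val x (g.leviCivita V x (X x)) (Z x)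
        - g.val x (g.leviCivita V x (X x)) (Y x) * g.val x (U x) (Z x)
        - g.val x (V x) (Y x) * g.val x (g.leviCivita U x (X x)) (Z x) := by
  have m1 := g.mdiffAt hU hY
  have m2 := g.mdiffAt hV hZ
  have m3 := g.mdiffAt hV hY
  have m4 := g.mdiffAt hU hZ
  simp only [covTensor, wedge_apply, mvfderiv_sub_apply (mdiffAt_mul m1 m2) (mdiffAt_mul m3 m4),
    mvfderiv_mul_apply m1 m2, mvfderiv_mul_apply m3 m4, g.leviCivita_metric hU hY,
    g.leviCivita_metric hV hZ, g.leviCivita_metric hV hY, g.leviCivita_metric hU hZ]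
  ring

end CovTensor

/-! ### The transverse planes and their area form -/

section Transverse

/-- The metric of the planes orthogonal to `u` and `u̇`, multiplied by `η`. -/
def transverse (g : LorentzMetric M) (u : VField M) (x : M) (v w : TangentSpace (𝓡 4) x) : ℝ :=
  g.eta u x * (g.val x v w + g.val x (u x) v * g.val x (u x) w)
    - g.val x (g.accel u x) v * g.val x (g.accel u x) w

variable {V W X Y Z : VField M}

theorem transverse_eq (hu : g.IsStatic u) (hyz : g.IsTransversePair u y z)
    (v w : TangentSpace (𝓡 4) x) : g.transverse u x v w
      = g.eta u x * (g.val x (y x) v * g.val x (y x) w + g.val x (z x) v * g.val x (z x) w) := by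
  have hη := hu.eta_pos x
  rw [transverse, val_eq hu hyz v w]
  field_simp
  ring

theorem transverse_mdiffAt (hu : g.IsStatic u) (hY : VDiffAt Y x) (hV : VDiffAt V x) :
    MDifferentiableAt (𝓡 4) 𝓘(ℝ) (fun p ↦ g.transverse u p (Y p) (V p)) x :=
  ((hu.eta_mdiffAt x).mul ((g.mdiffAt hY hV).add
    ((g.mdiffAt (hu.vdiffAt x) hY).mul (g.mdiffAt (hu.vdiffAt x) hV)))).sub
    ((g.mdiffAt (hu.accel_vdiffAt x) hY).mul (g.mdiffAt (hu.accel_vdiffAt x) hV))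

/-- The derivative of `transverse`, for a second argument orthogonal to `u` and `u̇`. -/
theorem mvfderiv_transverse (hu : g.IsStatic u) (hY : VDiffAt Y x) (hV : VDiffAt V x)
    (hVu : g.val x (V x) (u x) = 0) (hVa : g.val x (V x) (g.accel u x) = 0)
    (v : TangentSpace (𝓡 4) x) :
    mvfderiv (𝓡 4) (fun p ↦ g.transverse u p (Y p) (V p)) x v
      = mvfderiv (𝓡 4) (g.eta u) x v * g.val x (V x) (Y x)
        - g.val x (g.accel u x) (Y x) * g.val x (g.leviCivita (g.accel u) x v) (V x)
        + g.transverse u x (g.leviCivita Y x v) (V x)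
        + g.transverse u x (Y x) (g.leviCivita V x v) := by
  have hη := hu.eta_mdiffAt x
  have m1 := g.mdiffAt hY hV
  have m2 := g.mdiffAt (hu.vdiffAt x) hY
  have m3 := g.mdiffAt (hu.vdiffAt x) hV
  have m4 := g.mdiffAt (hu.accel_vdiffAt x) hY
  have m5 := g.mdiffAt (hu.accel_vdiffAt x) hV
  rw [g.symm x] at hVu hVa
  have m23 := mdiffAt_mul m2 m3
  have m123 := mdiffAt_add m1 m23
  simp only [transverse, mvfderiv_sub_apply (mdiffAt_mul hη m123) (mdiffAt_mul m4 m5),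
    mvfderiv_mul_apply hη m123, mvfderiv_add_apply m1 m23,
    mvfderiv_mul_apply m2 m3, mvfderiv_mul_apply m4 m5, g.leviCivita_metric hY hV,
    g.leviCivita_metric (hu.vdiffAt x) hY, g.leviCivita_metric (hu.vdiffAt x) hV,
    g.leviCivita_metric (hu.accel_vdiffAt x) hY, g.leviCivita_metric (hu.accel_vdiffAt x) hV,
    hVu, hVa, hu.grad, g.symm x (V x) (Y x)]
  ring

/-- In a Euclidean plane, the product of two values of the area form is a Gram determinant. The left
side is built from g, u and u̇ only, so it can be differentiated without differentiating y or z. -/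
theorem wedge_mul_wedge (hu : g.IsStatic u) (hyz : g.IsTransversePair u y z)
    (v w v' w' : TangentSpace (𝓡 4) x) :
    g.transverse u x v v' * g.transverse u x w w' - g.transverse u x v w' * g.transverse u x w v'
      = g.eta u x * g.eta u x * (g.wedge y z x v w * g.wedge y z x v' w') := by
  simp only [transverse_eq hu hyz, wedge_apply]
  ring

/-- The covariant derivative of the area form of the planes orthogonal to `u` and `u̇`. -/
theorem eta_mul_covTensor_wedge (hu : g.IsStatic u) (hyz : g.IsTransversePair u y z)
    (hs : TensorSmooth (g.wedge y z)) (hY : VDiffAt Y x) (hZ : VDiffAt Z x) :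
    g.eta u x * g.covTensor (g.wedge y z) X Y Z x
      = -(g.val x (g.accel u x) (Y x)
            * g.wedge y z x (g.leviCivita (g.accel u) x (X x)) (Z x)
          + g.val x (g.accel u x) (Z x)
            * g.wedge y z x (Y x) (g.leviCivita (g.accel u) x (X x))) := by
  -- V and W are differentiable substitutes for y and z. They agree with them at x only, so the
  -- orthonormality relations may be used at x but not differentiated.
  let V : VField M := FiberBundle.extend (EuclideanSpace ℝ (Fin 4)) (y x)
  let W : VField M := FiberBundle.extend (EuclideanSpace ℝ (Fin 4)) (z x)
  have hV : VDiffAt V x := vdiffAt_extend _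
  have hW : VDiffAt W x := vdiffAt_extend _
  have hVx : V x = y x := FiberBundle.extend_apply_self ..
  have hWx : W x = z x := FiberBundle.extend_apply_self ..
  have hη := hu.eta_mdiffAt x
  have hη0 := hu.eta_pos x
  have product_rule (Y Z : VField M) :=
    congr(mvfderiv (𝓡 4) $(funext fun p ↦ wedge_mul_wedge hu hyz (Y p) (Z p) (V p) (W p)) x (X x))
  have product_rule_at {Y Z : VField M} (hY : VDiffAt Y x) (hZ : VDiffAt Z x) :
      2 * g.eta u x * mvfderiv (𝓡 4) (g.eta u) x (X x) * g.wedge y z x (Y x) (Z x)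
        + g.eta u x ^ 2 * (mvfderiv (𝓡 4) (fun p ↦ g.wedge y z p (Y p) (Z p)) x (X x)
          + g.wedge y z x (Y x) (Z x)
            * mvfderiv (𝓡 4) (fun p ↦ g.wedge y z p (V p) (W p)) x (X x))
        = mvfderiv (𝓡 4) (fun p ↦ g.transverse u p (Y p) (V p)) x (X x)
            * (g.eta u x * g.val x (z x) (Z x))
          + g.eta u x * g.val x (y x) (Y x)
            * mvfderiv (𝓡 4) (fun p ↦ g.transverse u p (Z p) (W p)) x (X x)
          - mvfderiv (𝓡 4) (fun p ↦ g.transverse u p (Y p) (W p)) x (X x)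
            * (g.eta u x * g.val x (y x) (Z x))
          - g.eta u x * g.val x (z x) (Y x)
            * mvfderiv (𝓡 4) (fun p ↦ g.transverse u p (Z p) (V p)) x (X x) := by
    have mVW := hs.mdiffAt hV hW
    have mYZ := hs.mdiffAt hY hZ
    have q1 := transverse_mdiffAt hu hY hV
    have q2 := transverse_mdiffAt hu hZ hW
    have q3 := transverse_mdiffAt hu hY hW
    have q4 := transverse_mdiffAt hu hZ hV
    have h := product_rule Y Z
    rw [mvfderiv_sub_apply (mdiffAt_mul q1 q2) (mdiffAt_mul q3 q4), mvfderiv_mul_apply q1 q2,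
      mvfderiv_mul_apply q3 q4, mvfderiv_mul_apply (mdiffAt_mul hη hη) (mdiffAt_mul mYZ mVW),
      mvfderiv_mul_apply hη hη, mvfderiv_mul_apply mYZ mVW] at h
    simp only [hVx, hWx, transverse_eq hu hyz _ (y x), transverse_eq hu hyz _ (z x),
      wedge_apply, hyz.y_unit, hyz.z_unit, hyz.y_orth_z, g.symm x (z x) (y x)] at h ⊢
    linear_combination -h
  have dT {Y : VField M} (hY : VDiffAt Y x) :=
    mvfderiv_transverse hu hY hV (by rw [hVx, hyz.y_orth_u]) (by rw [hVx, hyz.y_orth_accel]) (X x)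
  have dT' {Y : VField M} (hY : VDiffAt Y x) :=
    mvfderiv_transverse hu hY hW (by rw [hWx, hyz.z_orth_u]) (by rw [hWx, hyz.z_orth_accel]) (X x)
  -- This instance determines the unknown derivative of ω(V, W), whose value at x is 1. Half of ω(Y,
  -- Z) times it cancels that derivative from `h2`.
  have h1 := product_rule_at hV hW
  have h2 := product_rule_at hY hZ
  rw [dT hV, dT' hV, dT hW, dT' hW] at h1
  rw [dT hY, dT' hY, dT hZ, dT' hZ] at h2
  simp only [covTensor]
  simp only [hVx, hWx, transverse_eq hu hyz, wedge_apply, hyz.y_unit, hyz.z_unit, hyz.y_orth_z,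
    g.symm x (z x) (y x), g.symm x (g.accel u x) (y x), g.symm x (g.accel u x) (z x),
    hyz.y_orth_accel, hyz.z_orth_accel, g.symm x _ (y x), g.symm x _ (z x)] at h1 h2 ⊢
  apply mul_left_cancel₀ hη0.ne'
  linear_combination h2 - (g.val x (y x) (Y x) * g.val x (z x) (Z x)
    - g.val x (z x) (Y x) * g.val x (y x) (Z x)) / 2 * h1

end Transverse

/-! ### The exterior derivative of the field tensor, and ϰ -/

section Faraday

variable {X Y Z : VField M} {E B : M → ℝ}

/-- The value `(dF)(X, Y, Z)` for the field tensor `F`, multiplied by `η`. -/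
theorem eta_mul_cyclic_covTensor_fieldTensor (hu : g.IsStatic u) (hyz : g.IsTransversePair u y z)
    (hs : TensorSmooth (g.wedge y z)) (hE : ContMDiff (𝓡 4) 𝓘(ℝ) ∞ E)
    (hB : ContMDiff (𝓡 4) 𝓘(ℝ) ∞ B) (hB_dot : mvfderiv (𝓡 4) B x (u x) = 0)
    (hX : VDiffAt X x) (hY : VDiffAt Y x) (hZ : VDiffAt Z x) :
    g.eta u x * (g.covTensor (g.fieldTensor u y z E B) X Y Z x
        + g.covTensor (g.fieldTensor u y z E B) Y Z X x
        + g.covTensor (g.fieldTensor u y z E B) Z X Y x)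
      = g.eta u x *
          (mvfderiv (𝓡 4) (fun p ↦ E p / √(g.eta u p)) x (X x)
              * g.wedge u (g.accel u) x (Y x) (Z x)
            + mvfderiv (𝓡 4) (fun p ↦ E p / √(g.eta u p)) x (Y x)
              * g.wedge u (g.accel u) x (Z x) (X x)
            + mvfderiv (𝓡 4) (fun p ↦ E p / √(g.eta u p)) x (Z x)
              * g.wedge u (g.accel u) x (X x) (Y x))
        + (g.val x (g.accel u x) (X x) * g.wedge y z x (Y x) (Z x)
            + g.val x (g.accel u x) (Y x) * g.wedge y z x (Z x) (X x)
            + g.val x (g.accel u x) (Z x) * g.wedge y z x (X x) (Y x))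
          * (mvfderiv (𝓡 4) B x (g.accel u x) - B x * (g.eta u x - g.divergence (g.accel u) x
              + mvfderiv (𝓡 4) (g.eta u) x (g.accel u x) / (2 * g.eta u x))) := by
  have hη := hu.eta_pos x
  have hφd := (hu.div_sqrt_eta_smooth hE x).mdifferentiableAt (by simp)
  have hBd := (hB x).mdifferentiableAt (by simp)
  have hud := hu.vdiffAt x
  have had := hu.accel_vdiffAt x
  have expand (X : VField M) {Y Z : VField M} (hY : VDiffAt Y x) (hZ : VDiffAt Z x) :
      g.covTensor (g.fieldTensor u y z E B) X Y Z x
        = mvfderiv (𝓡 4) (fun p ↦ E p / √(g.eta u p)) x (X x)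
            * g.wedge u (g.accel u) x (Y x) (Z x)
          + E x / √(g.eta u x) * g.covTensor (g.wedge u (g.accel u)) X Y Z x
          + (mvfderiv (𝓡 4) B x (X x) * g.wedge y z x (Y x) (Z x)
            + B x * g.covTensor (g.wedge y z) X Y Z x) := by
    have w1 := wedge_mdiffAt (g := g) hud had hY hZ
    have w2 := hs.mdiffAt hY hZ
    rw [← covTensor_smul hφd w1, ← covTensor_smul hBd w2]
    exact covTensor_add (T := fun p ↦ (E p / √(g.eta u p)) • g.wedge u (g.accel u) p)
      (S := fun p ↦ B p • g.wedge y z p) (mdiffAt_mul hφd w1) (mdiffAt_mul hBd w2)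
  -- `dB` and `dS` expand d𝔹 and ∇u̇ in the frame. Neither has a u-term: for d𝔹 because u(𝔹) = 0,
  -- and for ∇u̇ paired with w ⟂ u because g(∇_u u̇, w) = g(∇_w u̇, u) = η g(u, w) = 0.
  have dB (v : TangentSpace (𝓡 4) x) : g.eta u x * mvfderiv (𝓡 4) B x v
      = g.val x (g.accel u x) v * mvfderiv (𝓡 4) B x (g.accel u x)
        + g.eta u x * (g.val x (y x) v * mvfderiv (𝓡 4) B x (y x)
          + g.val x (z x) v * mvfderiv (𝓡 4) B x (z x)) := by
    conv_lhs => rw [frame_expansion hu hyz v]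
    simp only [map_add, map_smul, smul_eq_mul, hB_dot]
    field_simp
    ring
  have dS (v w : TangentSpace (𝓡 4) x) (hw : g.val x w (u x) = 0) :
      g.eta u x * g.val x w (g.leviCivita (g.accel u) x v)
      = g.val x (g.accel u x) v * g.val x w (g.leviCivita (g.accel u) x (g.accel u x))
        + g.eta u x * (g.val x (y x) v * g.val x w (g.leviCivita (g.accel u) x (y x))
          + g.val x (z x) v * g.val x w (g.leviCivita (g.accel u) x (z x))) := by
    have h0 : g.val x w (g.leviCivita (g.accel u) x (u x)) = 0 := by
      rw [g.symm, hu.closed, hu.val_leviCivita_accel, g.symm, hw, mul_zero]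
    conv_lhs => rw [frame_expansion hu hyz v]
    simp only [map_add, map_smul, smul_eq_mul, h0]
    field_simp
    ring
  have dyz : g.val x (y x) (g.leviCivita (g.accel u) x (z x))
      = g.val x (z x) (g.leviCivita (g.accel u) x (y x)) := by
    rw [g.symm, hu.closed, g.symm]
  have dSy v := dS v (y x) (hyz.y_orth_u x)
  have dSz v := dS v (z x) (hyz.z_orth_u x)
  simp only [dyz] at dSy
  -- This is d(u∧u̇) = 0: the terms from ∇u contain u̇ twice and cancel, and those from ∇u̇ cancel
  -- by symmetry.
  have cyc_wedge : g.covTensor (g.wedge u (g.accel u)) X Y Z x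
      + g.covTensor (g.wedge u (g.accel u)) Y Z X x
      + g.covTensor (g.wedge u (g.accel u)) Z X Y x = 0 := by
    rw [covTensor_wedge hud had hY hZ, covTensor_wedge hud had hZ hX,
      covTensor_wedge hud had hX hY]
    simp only [hu.grad]
    rw [hu.closed x (Y x) (X x), hu.closed x (Z x) (X x), hu.closed x (Z x) (Y x)]
    ring
  have c1 := eta_mul_covTensor_wedge (X := X) hu hyz hs hY hZ
  have c2 := eta_mul_covTensor_wedge (X := Y) hu hyz hs hZ hX
  have c3 := eta_mul_covTensor_wedge (X := Z) hu hyz hs hX hY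
  have hdiv := divergence_accel hu hyz x
  rw [g.symm x _ (y x), g.symm x _ (z x)] at hdiv
  rw [expand X hY hZ, expand Y hZ hX, expand Z hX hY, hdiv]
  simp only [wedge_apply] at c1 c2 c3 ⊢
  apply mul_left_cancel₀ hη.ne'
  -- After antisymmetrization only the u̇-component of d𝔹 and the trace of ∇u̇ over y, z survive;
  -- the mixed yz entries cancel through `dyz`.
  linear_combination (g.eta u x ^ 2 * (E x / √(g.eta u x))) * cyc_wedge
    + g.eta u x * B x * (c1 + c2 + c3)
    + g.eta u x * (g.val x (y x) (Y x) * g.val x (z x) (Z x)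
        - g.val x (z x) (Y x) * g.val x (y x) (Z x))
      * dB (X x)
    - B x * (g.val x (g.accel u x) (Y x) * g.val x (z x) (Z x)
      - g.val x (g.accel u x) (Z x) * g.val x (z x) (Y x)) * dSy (X x)
    + B x * (g.val x (g.accel u x) (Y x) * g.val x (y x) (Z x)
      - g.val x (g.accel u x) (Z x) * g.val x (y x) (Y x)) * dSz (X x)
    + g.eta u x * (g.val x (y x) (Z x) * g.val x (z x) (X x)
        - g.val x (z x) (Z x) * g.val x (y x) (X x))
      * dB (Y x)
    - B x * (g.val x (g.accel u x) (Z x) * g.val x (z x) (X x)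
      - g.val x (g.accel u x) (X x) * g.val x (z x) (Z x)) * dSy (Y x)
    + B x * (g.val x (g.accel u x) (Z x) * g.val x (y x) (X x)
      - g.val x (g.accel u x) (X x) * g.val x (y x) (Z x)) * dSz (Y x)
    + g.eta u x * (g.val x (y x) (X x) * g.val x (z x) (Y x)
        - g.val x (z x) (X x) * g.val x (y x) (Y x))
      * dB (Z x)
    - B x * (g.val x (g.accel u x) (X x) * g.val x (z x) (Y x)
      - g.val x (g.accel u x) (Y x) * g.val x (z x) (X x)) * dSy (Z x)
    + B x * (g.val x (g.accel u x) (X x) * g.val x (y x) (Y x)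
      - g.val x (g.accel u x) (Y x) * g.val x (y x) (X x)) * dSz (Z x)

/-- The equations `∇(𝔼/√η) = ϰ u̇` and `u̇(𝔹) = …` characterise Faraday tensors. -/
theorem isFaraday_fieldTensor_iff (hu : g.IsStatic u) (hyz : g.IsTransversePair u y z)
    (hs : TensorSmooth (g.wedge y z)) (hE : ContMDiff (𝓡 4) 𝓘(ℝ) ∞ E)
    (hB : ContMDiff (𝓡 4) 𝓘(ℝ) ∞ B) (hE_dot : ∀ x, mvfderiv (𝓡 4) E x (u x) = 0)
    (hB_dot : ∀ x, mvfderiv (𝓡 4) B x (u x) = 0) :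
    g.IsFaraday (g.fieldTensor u y z E B) ↔
      (∃ κ : M → ℝ, ∀ (x : M) (v : TangentSpace (𝓡 4) x),
        mvfderiv (𝓡 4) (fun p ↦ E p / √(g.eta u p)) x v = κ x * g.val x (g.accel u x) v) ∧
      ∀ x, mvfderiv (𝓡 4) B x (g.accel u x) =
        B x * (g.eta u x - g.divergence (g.accel u) x
          + mvfderiv (𝓡 4) (g.eta u) x (g.accel u x) / (2 * g.eta u x)) := by
  constructor
  · intro hF
    have apply_frame (x : M) {X Y Z : VField M} (hX : VDiffAt X x) (hY : VDiffAt Y x)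
        (hZ : VDiffAt Z x) :=
      (eta_mul_cyclic_covTensor_fieldTensor hu hyz hs hE hB (hB_dot x) hX hY hZ).symm.trans
        ((congrArg (g.eta u x * ·) (hF x X Y Z hX hY hZ)).trans (mul_zero _))
    have haa (x : M) : g.val x (g.accel u x) (g.accel u x) = g.eta u x := rfl
    have sy (x : M) (v) := g.symm x v (y x)
    have sz (x : M) (v) := g.symm x v (z x)
    constructor
    · refine ⟨fun x ↦ mvfderiv (𝓡 4) (fun p ↦ E p / √(g.eta u p)) x (g.accel u x) / g.eta u x,
        fun x v ↦ ?_⟩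
      have hη := hu.eta_pos x
      -- On (u, u̇, y) and (u, u̇, z) the form u̇∧y∧z vanishes, leaving -η² times the derivative of
      -- 𝔼/√η along y or z.
      have h2 := apply_frame x (hu.vdiffAt x) (hu.accel_vdiffAt x) (vdiffAt_extend (y x))
      have h3 := apply_frame x (hu.vdiffAt x) (hu.accel_vdiffAt x) (vdiffAt_extend (z x))
      simp only [FiberBundle.extend_apply_self, wedge_apply, hu.unit, hu.val_accel,
        hu.val_accel', haa, sy x (u x), sy x (g.accel u x), sz x (u x), sz x (g.accel u x),
        hyz.y_orth_u, hyz.z_orth_u, hyz.y_orth_accel, hyz.z_orth_accel] at h2 h3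
      have hy : mvfderiv (𝓡 4) (fun p ↦ E p / √(g.eta u p)) x (y x) = 0 := by
        refine (mul_eq_zero.1 (?_ : (g.eta u x) ^ 2 * _ = 0)).resolve_left (by positivity)
        linear_combination -h2
      have hz : mvfderiv (𝓡 4) (fun p ↦ E p / √(g.eta u p)) x (z x) = 0 := by
        refine (mul_eq_zero.1 (?_ : (g.eta u x) ^ 2 * _ = 0)).resolve_left (by positivity)
        linear_combination -h3
      conv_lhs => rw [frame_expansion hu hyz v]
      simp only [map_add, map_smul, smul_eq_mul, hy, hz,
        hu.mvfderiv_div_sqrt_eta hE (hE_dot x)]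
      ring
    · intro x
      have hη := hu.eta_pos x
      -- On (u̇, y, z) every term containing u∧u̇ vanishes, while u̇∧y∧z takes the value η.
      have h1 := apply_frame x (hu.accel_vdiffAt x) (vdiffAt_extend (y x)) (vdiffAt_extend (z x))
      simp only [FiberBundle.extend_apply_self, wedge_apply, hu.val_accel, haa, sy x (u x),
        sy x (g.accel u x), sz x (u x), sz x (g.accel u x), sy x (z x), hyz.y_unit, hyz.z_unit,
        hyz.y_orth_z, hyz.y_orth_u, hyz.z_orth_u, hyz.y_orth_accel, hyz.z_orth_accel] at h1
      refine sub_eq_zero.1 ((mul_eq_zero.1 (?_ : g.eta u x * _ = 0)).resolve_left hη.ne')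
      linear_combination h1
  · rintro ⟨⟨κ, hκ⟩, hB'⟩ x X Y Z hX hY hZ
    have h := eta_mul_cyclic_covTensor_fieldTensor hu hyz hs hE hB (hB_dot x) hX hY hZ
    rw [hB' x, sub_self, mul_zero, add_zero] at h
    rw [mul_left_cancel₀ (hu.eta_pos x).ne' h]
    -- What remains is ϰ u̇∧u∧u̇, which is zero by antisymmetry.
    simp only [hκ, wedge_apply]
    ring

/-- Evaluation on u̇, where g(u̇, u̇) = η > 0, leaves only one candidate for ϰ; its smoothness is
read off from this formula. -/
theorem kappa_eq (hu : g.IsStatic u) {κ : M → ℝ}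
    (hκ : ∀ (x : M) (v : TangentSpace (𝓡 4) x),
      mvfderiv (𝓡 4) (fun p ↦ E p / √(g.eta u p)) x v = κ x * g.val x (g.accel u x) v) :
    κ = fun x ↦ mvfderiv (𝓡 4) (fun p ↦ E p / √(g.eta u p)) x (g.accel u x) / g.eta u x := by
  ext x
  rw [hκ]
  exact (mul_div_cancel_right₀ _ (hu.eta_pos x).ne').symm

theorem kappa_smooth (hu : g.IsStatic u) (hE : ContMDiff (𝓡 4) 𝓘(ℝ) ∞ E) {κ : M → ℝ}
    (hκ : ∀ (x : M) (v : TangentSpace (𝓡 4) x),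
      mvfderiv (𝓡 4) (fun p ↦ E p / √(g.eta u p)) x v = κ x * g.val x (g.accel u x) v) :
    ContMDiff (𝓡 4) 𝓘(ℝ) ∞ κ := by
  rw [kappa_eq hu hκ]
  intro x
  exact (contMDiffAt_mvfderiv_apply (hu.div_sqrt_eta_smooth hE x) (hu.accel_smooth x)).div₀
    (hu.eta_smooth x) (hu.eta_pos x).ne'

/-- With φ = 𝔼/√η, one has u(φ) = 0 and u̇(φ) = ϰη, so the commutator identity reads u(ϰη) = ϰ g(u̇,
[u, u̇]). Both parts of [u, u̇] = ∇_u u̇ - ∇_u̇ u are orthogonal to u̇, hence u(ϰη) = 0, and u(η) =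
0 gives the claim. The field u also serves as the nonvanishing auxiliary field. -/
theorem mvfderiv_kappa (hu : g.IsStatic u) (hE : ContMDiff (𝓡 4) 𝓘(ℝ) ∞ E) {κ : M → ℝ}
    (hκ : ∀ (x : M) (v : TangentSpace (𝓡 4) x),
      mvfderiv (𝓡 4) (fun p ↦ E p / √(g.eta u p)) x v = κ x * g.val x (g.accel u x) v) (x : M) :
    mvfderiv (𝓡 4) κ x (u x) = 0 := by
  have hη := hu.eta_pos x
  have hu0 : u x ≠ 0 := fun h ↦ by simpa [h] using hu.unit x
  have hκd := (kappa_smooth hu hE hκ x).mdifferentiableAt (by simp)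
  have h := mvfderiv_mlieBracket (x := x) (hu.div_sqrt_eta_smooth hE) hu.smooth hu.accel_smooth
    hu.smooth hu0
  simp only [hκ, hu.val_accel', mul_zero, mvfderiv_const, zero_apply, sub_zero] at h
  rw [← g.leviCivita_torsion_free (hu.vdiffAt x) (hu.accel_vdiffAt x), map_sub,
    g.symm x _ (g.leviCivita (g.accel u) x (u x)), g.symm x _ (g.leviCivita u x (g.accel u x)),
    hu.closed, hu.val_leviCivita_accel, hu.grad, hu.val_accel] at h
  have h' : mvfderiv (𝓡 4) (fun p ↦ κ p * g.eta u p) x (u x) = 0 := by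
    refine h.trans ?_
    simp
  rw [mvfderiv_mul_apply hκd (hu.eta_mdiffAt x), hu.mvfderiv_eta_self, mul_zero, zero_add] at h'
  exact (mul_eq_zero.1 h').resolve_left hη.ne'

end Faraday

end LorentzMetric

end StaticFaraday

end

theorem mainTheorem1 {M : Type*} [TopologicalSpace M]
    [ChartedSpace (EuclideanSpace ℝ (Fin 4)) M] [IsManifold (𝓡 4) ∞ M]
    (g : StaticFaraday.LorentzMetric M) (u y z : StaticFaraday.VField M) (E B : M → ℝ)
    (hu : g.IsStatic u) (hyz : g.IsTransversePair u y z)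
    (hyz_smooth : StaticFaraday.TensorSmooth (g.wedge y z))
    (hE : ContMDiff (𝓡 4) 𝓘(ℝ) ∞ E) (hB : ContMDiff (𝓡 4) 𝓘(ℝ) ∞ B)
    (hE_dot : ∀ x, mvfderiv (𝓡 4) E x (u x) = 0)
    (hB_dot : ∀ x, mvfderiv (𝓡 4) B x (u x) = 0) :
    (g.IsFaraday (g.fieldTensor u y z E B) ↔
      (∃ κ : M → ℝ, ∀ (x : M) (v : TangentSpace (𝓡 4) x),
        mvfderiv (𝓡 4) (fun p ↦ E p / √(g.eta u p)) x v = κ x * g.val x (g.accel u x) v) ∧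
      ∀ x, mvfderiv (𝓡 4) B x (g.accel u x) =
        B x * (g.eta u x - g.divergence (g.accel u) x
          + mvfderiv (𝓡 4) (g.eta u) x (g.accel u x) / (2 * g.eta u x))) ∧
    (∀ κ : M → ℝ,
      (∀ (x : M) (v : TangentSpace (𝓡 4) x),
        mvfderiv (𝓡 4) (fun p ↦ E p / √(g.eta u p)) x v = κ x * g.val x (g.accel u x) v) →
      ContMDiff (𝓡 4) 𝓘(ℝ) ∞ κ ∧ ∀ x, mvfderiv (𝓡 4) κ x (u x) = 0) := by
  exact ⟨StaticFaraday.LorentzMetric.isFaraday_fieldTensor_iff hu hyz hyz_smooth hE hB hE_dot hB_dot,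
    fun κ hκ ↦ ⟨StaticFaraday.LorentzMetric.kappa_smooth hu hE hκ,
      StaticFaraday.LorentzMetric.mvfderiv_kappa hu hE hκ⟩⟩
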